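/- **Theorem (No loss of precision).** Let $1<p<\infty$ and let $\ell_p$ be the Banach space of real sequences $x=(x_i)_{i\ge 0}$ with $\|x\|_p=(\sum_i|x_i|^p)^{1/p}<\infty$. For $n\ge 0$ let $r_n:\mathbb{R}\to[-n,n]$ be the map that fixes the points of $[-n,n]$ and sends $t>n$ to $n$ and $t<-n$ to $-n$, and let $g_n:\ell_p\to\ell_p$, $g_n(x)=(r_n(x_0),\dots,r_n(x_{n-1}),0,0,\dots)$. Let $S_n=g_n(\ell_p)$ with the metric of $\ell_p$, let $q_n:\ell_p\to S_n$ be given by $q_n(x)=g_n(x)$, and let $p_n=q_n|_{S_{n+1}}:S_{n+1}\to S_n$. Let $$\overline{S}=\Big\{(s_n)_n\in\prod_n S_n \;:\; s_n=p_n(s_{n+1})\text{ for all }n\Big\}$$ be the limit of the inverse sequence $(p_n)_n$ in Hausdorff spaces, with the topology induced by the product topology, and let $\iota:\ell_p\to\overline{S}$ be the continuous map $\iota(x)=(q_n(x))_n$. For $C$ closed in $\ell_p$ and $D$ closed in $\overline{S}$ put $\iota_*(C)=\overline{\iota(C)}$ (closure in $\overline{S}$) and $\iota^*(D)=\iota^{-1}(D)$.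 Then for every norm-closed subset $C$ of $\ell_p$ the following are equivalent: 1. $C$ is bounded and $C=\iota^*(\iota_*(C))$, i.e. there is no loss of precision over $C$; 2. $C$ is the intersection of a nonempty (possibly infinite) family of sets, each of which is a finite union of closed balls of $\ell_p$ (of positive finite radius); 3. $C$ is the intersection of a nonempty (possibly infinite) family of sets, each of which is a finite union of bounded closed convex subsets of $\ell_p$. -/

import Mathlib

open scoped ENNReal

noncomputable section

namespace SeqSpace

/-- The real sequence space `ℓ_p`. -/
abbrev Ell (p : ℝ≥0∞) : Type := lp (fun _ : ℕ => ℝ) p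

/-- The retraction `r_n` of `ℝ` onto the interval `[-n, n]`: it fixes the points of `[-n, n]`,
sends `t > n` to `n` and `t < -n` to `-n`. -/
def clamp (n : ℕ) (t : ℝ) : ℝ := max (-(n : ℝ)) (min (n : ℝ) t)

theorem clamp_zero (n : ℕ) : clamp n 0 = 0 := by
  simp [clamp]

theorem clamp_clamp_of_le {m n : ℕ} (h : m ≤ n) (t : ℝ) : clamp m (clamp n t) = clamp m t := by
  have h' : (m : ℝ) ≤ n := by exact_mod_cast h
  have h0 : (0 : ℝ) ≤ m := Nat.cast_nonneg m
  unfold clamp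
  grind

theorem abs_clamp_sub_clamp_le (n : ℕ) (s t : ℝ) : |clamp n s - clamp n t| ≤ |s - t| := by
  have h0 : (0 : ℝ) ≤ n := Nat.cast_nonneg n
  unfold clamp
  grind

/-- The coordinates of `g_n x = (r_n(x_0), …, r_n(x_{n-1}), 0, 0, …)`. -/
def truncFun (n : ℕ) (x : ℕ → ℝ) : ℕ → ℝ := fun i => if i < n then clamp n (x i) else 0

theorem memℓp_truncFun (p : ℝ≥0∞) (n : ℕ) (x : ℕ → ℝ) : Memℓp (truncFun n x) p := by
  refine (memℓp_zero ?_).of_exponent_ge (zero_le : 0 ≤ p)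
  refine (Set.finite_Iio n).subset fun i hi => ?_
  by_contra h
  exact hi (if_neg h)

/-- The short idempotent `g_n` of `ℓ_p`. -/
def trunc (p : ℝ≥0∞) (n : ℕ) (x : Ell p) : Ell p :=
  ⟨truncFun n x, memℓp_truncFun p n x⟩

theorem trunc_trunc_of_le (p : ℝ≥0∞) {m n : ℕ} (h : m ≤ n) (x : Ell p) :
    trunc p m (trunc p n x) = trunc p m x := by
  apply lp.ext
  funext i
  change truncFun m (truncFun n x) i = truncFun m x i
  unfold truncFun
  by_cases hi : i < m
  · simp [hi, hi.trans_le h, clamp_clamp_of_le h]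
  · simp [hi]

theorem lipschitzWith_trunc (p : ℝ≥0∞) [Fact (1 ≤ p)] (n : ℕ) :
    LipschitzWith 1 (trunc p n) := by
  refine LipschitzWith.of_dist_le_mul fun x y => ?_
  have hp : p ≠ 0 := (zero_lt_one.trans_le (Fact.out : 1 ≤ p)).ne'
  rw [NNReal.coe_one, one_mul, dist_eq_norm, dist_eq_norm]
  refine lp.norm_mono hp fun i => ?_
  change |truncFun n x i - truncFun n y i| ≤ |x i - y i|
  unfold truncFun
  split_ifs
  · exact abs_clamp_sub_clamp_le n _ _
  · simp

/-- The `n`-th approximant `S_n` of `ℓ_p`: the image of `g_n`, a compact metric subspace. -/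
abbrev Approx (p : ℝ≥0∞) (n : ℕ) : Type := Set.range (trunc p n)

/-- The projection `q_n : ℓ_p → S_n`; followed by the inclusion of `S_n` it is `g_n`. -/
def proj (p : ℝ≥0∞) (n : ℕ) (x : Ell p) : Approx p n := ⟨trunc p n x, x, rfl⟩

theorem continuous_proj (p : ℝ≥0∞) [Fact (1 ≤ p)] (n : ℕ) : Continuous (proj p n) :=
  (lipschitzWith_trunc p n).continuous.subtype_mk _

/-- The bonding map `p_n : S_{n+1} → S_n`, the inclusion of `S_{n+1}` in `ℓ_p` followed
by `q_n`. -/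
def bond (p : ℝ≥0∞) (n : ℕ) (x : Approx p (n + 1)) : Approx p n := proj p n x

/-- The limit, in Hausdorff spaces, of the inverse sequence of the `S_n` along the bonding maps:
the threads, with the topology induced by the product topology. -/
abbrev Limit (p : ℝ≥0∞) : Type := {s : ∀ n, Approx p n // ∀ n, s n = bond p n (s (n + 1))}

/-- The map from `ℓ_p` into the limit whose `n`-th component is `q_n`. -/
def toLimit (p : ℝ≥0∞) [Fact (1 ≤ p)] : C(Ell p, Limit p) where
  toFun x := ⟨fun n => proj p n x, fun n =>
    Subtype.ext (trunc_trunc_of_le p n.le_succ x).symm⟩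
  continuous_toFun := (continuous_pi fun n => continuous_proj p n).subtype_mk _

/-- `f_*`, which takes a closed set to the closure of its image. -/
def push {X Y : Type*} [TopologicalSpace X] [TopologicalSpace Y] (f : C(X, Y))
    (C : TopologicalSpace.Closeds X) : TopologicalSpace.Closeds Y :=
  TopologicalSpace.Closeds.closure (f '' (C : Set X))

/-- `f^*`, which takes a closed set to its preimage. -/
def pull {X Y : Type*} [TopologicalSpace X] [TopologicalSpace Y] (f : C(X, Y))
    (D : TopologicalSpace.Closeds Y) : TopologicalSpace.Closeds X :=
  D.preimage f.continuous

/-- `A` is the union of a finite family of sets that satisfy `P`. -/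
def IsFiniteUnion {X : Type*} (P : Set X → Prop) (A : Set X) : Prop :=
  ∃ 𝓑 : Set (Set X), 𝓑.Finite ∧ (∀ B ∈ 𝓑, P B) ∧ A = ⋃₀ 𝓑

/-- `C` is the intersection of a nonempty, possibly infinite, family of sets each of which is a
finite union of sets that satisfy `P`. -/
def IsInterOfFiniteUnions {X : Type*} (P : Set X → Prop) (C : Set X) : Prop :=
  ∃ 𝓐 : Set (Set X), 𝓐.Nonempty ∧ (∀ A ∈ 𝓐, IsFiniteUnion P A) ∧ C = ⋂₀ 𝓐

/-- Closed balls of positive finite radius. -/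
def IsClosedBall {X : Type*} [PseudoMetricSpace X] (B : Set X) : Prop :=
  ∃ (x : X) (r : ℝ), 0 < r ∧ B = Metric.closedBall x r

/-- Bounded closed convex sets. -/
def IsBoundedClosedConvex {X : Type*} [NormedAddCommGroup X] [NormedSpace ℝ X]
    (B : Set X) : Prop :=
  Bornology.IsBounded B ∧ IsClosed B ∧ Convex ℝ B

end SeqSpace

end

/-!
The map `toLimit` pulls the topology of the limit back to the topology of coordinatewise
convergence on `ℓ_p` (`induced_toLimit`), so that there is no loss of precision over `C` exactly
when `C` is closed for that topology (`eq_pull_push_iff`). The theorem thus compares bounded,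
coordinatewise closed sets with intersections of finite unions of balls or of convex sets.

If `C` is bounded and coordinatewise closed and `x ∉ C`, finitely many coordinates separate `x`
from `C` by some `ε`, so `C` is covered by finitely many sets `{y | ε ≤ ± (y - x) i}`. On a bounded
set each of these is covered by a single closed ball that misses `x`, of large radius and centred
far away from `x` in the direction `± e_i` (`exists_closedBall_separating`); this needs `1 < p`.

Conversely, it is enough that a bounded closed convex set `B` is coordinatewise closed, because
coordinatewise closed sets are stable under finite unions and arbitrary intersections. If `x` is a
coordinatewise limit of points of `B`, one picks points of `B` successively such that their
differences with `x` are almost disjointly supported. The average of `K` of them is at distance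
`O(K ^ (1 / p - 1))` from `x`, and lies in `B` by convexity; as `1 < p`, `x` is in the norm closure
of `B` (`zero_mem_closure_of_convex`). No duality is needed.
-/

namespace SeqSpace

open scoped Topology

/-! ### The topology induced by the limit -/

/-- The topology of coordinatewise convergence on `ℓ_p`. -/
abbrev coordTop (p : ℝ≥0∞) : TopologicalSpace (Ell p) :=
  TopologicalSpace.induced (fun (x : Ell p) (i : ℕ) => x i) inferInstance

/-- The vector of `ℓ_p` that agrees with the sequence `z` on the finite set `s` and vanishes
elsewhere. -/
noncomputable def head (p : ℝ≥0∞) (s : Finset ℕ) (z : ℕ → ℝ) : Ell p := ∑ i ∈ s, lp.single p i (z i)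

theorem head_apply (p : ℝ≥0∞) (s : Finset ℕ) (z : ℕ → ℝ) (i : ℕ) :
    head p s z i = if i ∈ s then z i else 0 := by
  rw [head, lp.coeFn_sum, Finset.sum_apply]
  simp only [lp.single_apply, Finset.sum_pi_single]

theorem continuous_head (p : ℝ≥0∞) [Fact (1 ≤ p)] (s : Finset ℕ) : Continuous (head p s) :=
  continuous_finsetSum s fun i _ =>
    (lp.isometry_single (p := p) (E := fun _ : ℕ => ℝ) i).continuous.comp (continuous_apply i)

theorem continuous_clamp (n : ℕ) : Continuous (clamp n) := by
  unfold clamp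
  fun_prop

theorem clamp_eq_of_clamp_mem_Ioo {n : ℕ} {t : ℝ} (h : clamp n t ∈ Set.Ioo (-(n : ℝ)) n) :
    clamp n t = t := by
  obtain ⟨h₁, h₂⟩ := h
  unfold clamp at *
  grind

theorem clamp_of_abs_le {n : ℕ} {t : ℝ} (h : |t| ≤ n) : clamp n t = t := by
  obtain ⟨h₁, h₂⟩ := abs_le.1 h
  unfold clamp
  grind

theorem trunc_eq_head (p : ℝ≥0∞) (n : ℕ) (x : Ell p) :
    trunc p n x = head p (Finset.range n) fun i => clamp n (x i) := by
  apply lp.ext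
  funext i
  rw [head_apply]
  simp [trunc, truncFun]

theorem continuous_comp_induced {X Y Z : Type*} [TopologicalSpace Y] [TopologicalSpace Z]
    (f : X → Y) {g : Y → Z} (hg : Continuous g) :
    Continuous[TopologicalSpace.induced f inferInstance, inferInstance] fun x => g (f x) :=
  continuous_iff_le_induced.2 <| by
    rw [← Function.comp_def, ← induced_compose]
    exact induced_mono (continuous_iff_le_induced.1 hg)

theorem continuous_limit_apply (p : ℝ≥0∞) [Fact (1 ≤ p)] (n : ℕ) :
    Continuous fun s : Limit p => (s.1 n : Ell p) :=
  continuous_subtype_val.comp ((continuous_apply n).comp continuous_subtype_val)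

theorem continuous_limit_of_forall {p : ℝ≥0∞} [Fact (1 ≤ p)] {X : Type*} [TopologicalSpace X]
    {f : X → Limit p} (h : ∀ n, Continuous fun x => ((f x).1 n : Ell p)) : Continuous f :=
  Continuous.subtype_mk (continuous_pi fun n => Continuous.subtype_mk (h n) _) _

/-- The topology that `ℓ_p` inherits from the limit is that of coordinatewise convergence: near
a given point, clamping at a large bound does not affect a given coordinate. -/
theorem induced_toLimit (p : ℝ≥0∞) [Fact (1 ≤ p)] :
    TopologicalSpace.induced (toLimit p) inferInstance = coordTop p := by
  apply le_antisymm
  · have hc : ∀ {i n : ℕ}, i < n →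
        Continuous[TopologicalSpace.induced (toLimit p) inferInstance, inferInstance]
          fun y : Ell p => clamp n (y i) := by
      intro i n hin
      have h := continuous_comp_induced (toLimit p)
        ((lp.lipschitzWith_one_eval (E := fun _ : ℕ => ℝ) p i).continuous.comp
          (continuous_limit_apply p n))
      convert h using 2 with y
      simp [toLimit, proj, trunc, truncFun, hin]
    refine continuous_iff_le_induced.1 ?_
    let : TopologicalSpace (Ell p) := TopologicalSpace.induced (toLimit p) inferInstance
    refine continuous_pi fun i => continuous_iff_continuousAt.2 fun x => ?_
    obtain ⟨n, hn⟩ := exists_nat_gt (max (i : ℝ) |x i|)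
    have hin : i < n := by exact_mod_cast (le_max_left _ _).trans_lt hn
    have hxn : |x i| < n := (le_max_right _ _).trans_lt hn
    -- Values of `clamp n` in the open interval come only from points that `clamp n` fixes.
    have hev : ∀ᶠ y in nhds x, clamp n (y i) ∈ Set.Ioo (-(n : ℝ)) n := by
      refine (hc hin).continuousAt.eventually_mem (isOpen_Ioo.mem_nhds ?_)
      rw [clamp_of_abs_le hxn.le]
      exact abs_lt.1 hxn
    exact (hc hin).continuousAt.congr (hev.mono fun y hy => clamp_eq_of_clamp_mem_Ioo hy)
  · refine continuous_iff_le_induced.1 (@continuous_limit_of_forall p _ _ (coordTop p) _ fun n => ?_)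
    have h : Continuous fun z : ℕ → ℝ => head p (Finset.range n) fun i => clamp n (z i) :=
      (continuous_head p _).comp
        (continuous_pi fun i => (continuous_clamp n).comp (continuous_apply i))
    convert continuous_comp_induced (fun (x : Ell p) (i : ℕ) => x i) h using 2 with x
    exact trunc_eq_head p n x

theorem eq_pull_push_iff (p : ℝ≥0∞) [Fact (1 ≤ p)] (C : TopologicalSpace.Closeds (Ell p)) :
    C = pull (toLimit p) (push (toLimit p) C) ↔ IsClosed[coordTop p] (C : Set (Ell p)) := by
  have key : (pull (toLimit p) (push (toLimit p) C) : Set (Ell p)) =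
      @closure _ (coordTop p) (C : Set (Ell p)) := by
    ext x
    rw [← induced_toLimit, closure_induced]
    rfl
  rw [← SetLike.coe_set_eq, key]
  exact eq_comm.trans (@closure_eq_iff_isClosed _ (coordTop p) _)

/-! ### Bounded closed convex sets are coordinatewise closed -/

theorem exists_norm_head_lt_of_mem_closure {p : ℝ≥0∞} [Fact (1 ≤ p)] {B : Set (Ell p)} {x : Ell p}
    (hx : x ∈ @closure _ (coordTop p) B) (s : Finset ℕ) {δ : ℝ} (hδ : 0 < δ) :
    ∃ y ∈ B, ‖head p s fun i => (y - x) i‖ < δ := by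
  have h := hx
  unfold coordTop at h
  rw [closure_induced, mem_closure_iff] at h
  have hc : Continuous fun z : ℕ → ℝ => ‖head p s fun i => z i - x i‖ :=
    ((continuous_head p s).comp (by fun_prop)).norm
  obtain ⟨_, hy, y, hyB, rfl⟩ := h {z | ‖head p s fun i => z i - x i‖ < δ}
    (isOpen_lt hc continuous_const) (by simpa [head] using hδ)
  exact ⟨y, hyB, hy⟩

theorem norm_add_rpow_of_disjoint {p : ℝ≥0∞} [Fact (1 ≤ p)] (hr : 0 < p.toReal) {a b : Ell p}
    (h : ∀ i, a i = 0 ∨ b i = 0) :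
    ‖a + b‖ ^ p.toReal = ‖a‖ ^ p.toReal + ‖b‖ ^ p.toReal := by
  refine (lp.hasSum_norm hr (a + b)).unique ?_
  convert (lp.hasSum_norm hr a).add (lp.hasSum_norm hr b) using 2 with i
  rcases h i with h | h <;> simp [h, Real.zero_rpow hr.ne']

/-- A vector that is small on the essential support of `u` is almost disjoint from `u`, so that
the `p`-th powers of the norms almost add up. -/
theorem exists_finset_norm_add_le {p : ℝ≥0∞} [Fact (1 ≤ p)] (hp : p < ∞) (u : Ell p) {δ : ℝ}
    (hδ : 0 < δ) : ∃ s : Finset ℕ, ∀ v : Ell p, ‖u + v‖ ≤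
      (‖u‖ ^ p.toReal + ‖v‖ ^ p.toReal) ^ p.toReal⁻¹ + ‖head p s v‖ + δ := by
  have hp0 : p ≠ 0 := (zero_lt_one.trans_le (Fact.out : 1 ≤ p)).ne'
  have hr : 0 < p.toReal := ENNReal.toReal_pos hp0 hp.ne
  obtain ⟨s, hs⟩ :=
    ((Metric.tendsto_nhds.1 (lp.hasSum_single hp.ne u) δ hδ)).exists
  replace hs : ‖u - head p s u‖ < δ := by
    rw [dist_comm, dist_eq_norm] at hs
    exact hs
  refine ⟨s, fun v => ?_⟩
  have hmain : ‖head p s u + (v - head p s v)‖ ≤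
      (‖u‖ ^ p.toReal + ‖v‖ ^ p.toReal) ^ p.toReal⁻¹ := by
    rw [Real.le_rpow_inv_iff_of_pos (norm_nonneg _) (by positivity) hr,
      norm_add_rpow_of_disjoint hr]
    · gcongr
      · exact lp.norm_mono hp0 fun i => by rw [head_apply]; split_ifs <;> simp
      · refine lp.norm_mono hp0 fun i => ?_
        rw [lp.coeFn_sub, Pi.sub_apply, head_apply]
        split_ifs <;> simp
    · intro i
      rw [lp.coeFn_sub, Pi.sub_apply, head_apply, head_apply]
      split_ifs <;> simp
  calc ‖u + v‖ = ‖head p s u + (v - head p s v) + head p s v + (u - head p s u)‖ := by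
        congr 1
        abel
    _ ≤ ‖head p s u + (v - head p s v)‖ + ‖head p s v‖ + ‖u - head p s u‖ := norm_add₃_le
    _ ≤ _ := by gcongr

/-- A Banach–Saks argument: a bounded convex set with elements arbitrarily small on every finite
set of coordinates contains averages of `K + 1` almost disjoint vectors, of norm
`O((K + 1) ^ (1 / p - 1))`. -/
theorem zero_mem_closure_of_convex {p : ℝ≥0∞} [Fact (1 ≤ p)] (hp₁ : 1 < p) (hp : p < ∞)
    {B : Set (Ell p)} (hB : Bornology.IsBounded B) (hconv : Convex ℝ B)
    (h : ∀ (s : Finset ℕ) (δ : ℝ), 0 < δ → ∃ y ∈ B, ‖head p s y‖ < δ) :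
    (0 : Ell p) ∈ closure B := by
  have hr₁ : 1 < p.toReal := by
    simpa using (ENNReal.toReal_lt_toReal ENNReal.one_ne_top hp.ne).2 hp₁
  have hr : 0 < p.toReal := zero_lt_one.trans hr₁
  obtain ⟨M, hM0, hM⟩ := hB.exists_pos_norm_le
  set r := p.toReal
  -- `M + 1` instead of the bound `M` leaves room, at each step, for the failure of exact
  -- disjointness.
  have hsums : ∀ K : ℕ, ∃ u : Ell p, ((K : ℝ) + 1)⁻¹ • u ∈ B ∧
      ‖u‖ ≤ ((M + 1) ^ r * ((K : ℝ) + 1)) ^ r⁻¹ := by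
    intro K
    induction K with
    | zero =>
      obtain ⟨y, hy, -⟩ := h ∅ 1 one_pos
      refine ⟨y, by simpa using hy, ?_⟩
      have : ((M + 1) ^ r) ^ r⁻¹ = M + 1 := Real.rpow_rpow_inv (by positivity) hr.ne'
      simp only [Nat.cast_zero, zero_add, mul_one, this]
      linarith [hM y hy]
    | succ K ih =>
      obtain ⟨u, huB, hu⟩ := ih
      rw [Real.le_rpow_inv_iff_of_pos (norm_nonneg _) (by positivity) hr] at hu
      have hlt : ((M + 1) ^ r * ((K : ℝ) + 1) + M ^ r) ^ r⁻¹ <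
          ((M + 1) ^ r * ((K : ℝ) + 1 + 1)) ^ r⁻¹ := by
        refine Real.rpow_lt_rpow (by positivity) ?_ (inv_pos.2 hr)
        have : M ^ r < (M + 1) ^ r := Real.rpow_lt_rpow hM0.le (by linarith) hr
        linarith
      set δ := (((M + 1) ^ r * ((K : ℝ) + 1 + 1)) ^ r⁻¹ -
        ((M + 1) ^ r * ((K : ℝ) + 1) + M ^ r) ^ r⁻¹) / 2 with hδ
      have hδ0 : 0 < δ := by rw [hδ]; linarith
      obtain ⟨s, hs⟩ := exists_finset_norm_add_le hp u hδ0
      obtain ⟨v, hvB, hv⟩ := h s δ hδ0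
      refine ⟨u + v, ?_, ?_⟩
      · have hK : (0 : ℝ) < (K : ℝ) + 1 := by positivity
        have := hconv huB hvB (a := ((K : ℝ) + 1) / (K + 1 + 1)) (b := 1 / ((K : ℝ) + 1 + 1))
          (by positivity) (by positivity) (by field_simp)
        convert this using 1
        rw [smul_smul, smul_add]
        push_cast
        congr 2 <;> field_simp
      · have hle : (‖u‖ ^ r + ‖v‖ ^ r) ^ r⁻¹ ≤ ((M + 1) ^ r * ((K : ℝ) + 1) + M ^ r) ^ r⁻¹ := by
          gcongr
          exact hM v hvB
        have := hs v
        push_cast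
        linarith
  choose u huB hu using hsums
  refine mem_closure_of_tendsto (f := fun K : ℕ => ((K : ℝ) + 1)⁻¹ • u K) (b := Filter.atTop) ?_
    (Filter.Eventually.of_forall huB)
  have hlim : Filter.Tendsto (fun K : ℕ => (M + 1) * ((K : ℝ) + 1) ^ (-(1 - r⁻¹)))
      Filter.atTop (nhds 0) := by
    have h1 : Filter.Tendsto (fun K : ℕ => (K : ℝ) + 1) Filter.atTop Filter.atTop :=
      Filter.tendsto_atTop_add_const_right _ _ tendsto_natCast_atTop_atTop
    simpa using ((tendsto_rpow_neg_atTop (sub_pos.2 (inv_lt_one_of_one_lt₀ hr₁))).comp h1).const_mul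
      (M + 1)
  refine squeeze_zero_norm (fun K => ?_) hlim
  have hK : (0 : ℝ) < (K : ℝ) + 1 := by positivity
  rw [norm_smul, Real.norm_of_nonneg (by positivity)]
  calc ((K : ℝ) + 1)⁻¹ * ‖u K‖
      ≤ ((K : ℝ) + 1)⁻¹ * ((M + 1) ^ r * ((K : ℝ) + 1)) ^ r⁻¹ := by gcongr; exact hu K
    _ = (M + 1) * ((K : ℝ) + 1) ^ (-(1 - r⁻¹)) := by
      rw [Real.mul_rpow (by positivity) hK.le, Real.rpow_rpow_inv (by positivity) hr.ne',
        neg_sub, Real.rpow_sub hK, Real.rpow_one]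
      field_simp

theorem IsBoundedClosedConvex.isClosed_coordTop {p : ℝ≥0∞} [Fact (1 ≤ p)] (hp₁ : 1 < p)
    (hp : p < ∞) {B : Set (Ell p)} (hB : IsBoundedClosedConvex B) : IsClosed[coordTop p] B := by
  obtain ⟨hbd, hcl, hconv⟩ := hB
  rw [← @closure_subset_iff_isClosed _ (coordTop p)]
  intro x hx
  have hbd' : Bornology.IsBounded ((fun z => x + z) ⁻¹' B) := by
    convert hbd.vadd (-x) using 1
    ext z
    simp [Set.mem_vadd_set_iff_neg_vadd_mem]
  have h0 := zero_mem_closure_of_convex hp₁ hp hbd' (hconv.translate_preimage_right x)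
    fun s δ hδ => by
      obtain ⟨y, hy, hlt⟩ := exists_norm_head_lt_of_mem_closure hx s hδ
      exact ⟨y - x, by simpa using hy, hlt⟩
  rw [(hcl.preimage (continuous_const_add x)).closure_eq] at h0
  simpa using h0

/-! ### Separation by finite unions of balls -/

/-- A closed ball of large radius, centred far out in the direction `± e_i`, is nearly a
half-space: it contains every point of a bounded set that lies beyond `x` by `ε` in that
direction, but not `x`. The `i`-th coordinate gains about `ε t ^ (p - 1)` in the `p`-th power of
the distance, which for `1 < p` outweighs the bounded contribution of the others. -/
theorem exists_closedBall_separating {p : ℝ≥0∞} [Fact (1 ≤ p)] (hp₁ : 1 < p) (hp : p < ∞)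
    (x : Ell p) (i : ℕ) {σ : ℝ} (hσ : |σ| = 1) {M ε : ℝ} (hε : 0 < ε) :
    ∃ B : Set (Ell p), IsClosedBall B ∧ x ∉ B ∧
      ∀ y : Ell p, ‖y - x‖ ≤ M → ε ≤ σ * (y - x) i → y ∈ B := by
  have hr₁ : 1 < p.toReal := by
    simpa using (ENNReal.toReal_lt_toReal ENNReal.one_ne_top hp.ne).2 hp₁
  have hr : 0 < p.toReal := zero_lt_one.trans hr₁
  have hp0 : p ≠ 0 := (zero_lt_one.trans hp₁).ne'
  set r := p.toReal
  set N := |M| with hN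
  have hN0 : 0 ≤ N := abs_nonneg M
  obtain ⟨t, ht, htN, htε⟩ : ∃ t : ℝ, N ^ r < ε * (t - ε) ^ (r - 1) ∧ N < t ∧ ε < t := by
    have h1 : Filter.Tendsto (fun t : ℝ => t - ε) Filter.atTop Filter.atTop :=
      Filter.tendsto_atTop_add_const_right _ _ Filter.tendsto_id
    have h2 := ((tendsto_rpow_atTop (sub_pos.2 hr₁)).comp h1).const_mul_atTop hε
    exact ((h2.eventually_gt_atTop (N ^ r)).and
      ((Filter.eventually_gt_atTop N).and (Filter.eventually_gt_atTop ε))).exists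
  have htε0 : 0 < t - ε := sub_pos.2 htε
  have ht0 : 0 < t := hε.trans htε
  have hlt : N ^ r + (t - ε) ^ r < t ^ r := by
    have e1 : (t - ε) ^ r = (t - ε) * (t - ε) ^ (r - 1) := by
      rw [mul_comm, ← Real.rpow_add_one htε0.ne', sub_add_cancel]
    have e2 : t ^ r = t * t ^ (r - 1) := by
      rw [mul_comm, ← Real.rpow_add_one ht0.ne', sub_add_cancel]
    have h3 : (t - ε) ^ (r - 1) ≤ t ^ (r - 1) :=
      Real.rpow_le_rpow htε0.le (by linarith) (by linarith)
    have h4 : t * (t - ε) ^ (r - 1) ≤ t * t ^ (r - 1) := by gcongr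
    rw [e1, e2]
    linarith
  have hpos : 0 < N ^ r + (t - ε) ^ r := by positivity
  refine ⟨_, ⟨x + lp.single p i (σ * t), (N ^ r + (t - ε) ^ r) ^ r⁻¹, by positivity, rfl⟩, ?_, ?_⟩
  · rw [Metric.mem_closedBall, not_le, dist_self_add_right,
      lp.norm_single (pos_iff_ne_zero.2 hp0), Real.norm_eq_abs, abs_mul, hσ, one_mul,
      abs_of_pos ht0]
    rwa [Real.rpow_inv_lt_iff_of_pos hpos.le ht0.le hr]
  · intro y hy hyi
    set z := y - x with hz
    have hzi : σ * z i ≤ N := by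
      calc σ * z i ≤ |σ * z i| := le_abs_self _
        _ = ‖z i‖ := by rw [abs_mul, hσ, one_mul, Real.norm_eq_abs]
        _ ≤ ‖z‖ := lp.norm_apply_le_norm hp0 z i
        _ ≤ N := hy.trans (le_abs_self M)
    have hσσ : σ * σ = 1 := by rw [← abs_mul_abs_self, hσ, one_mul]
    have hsplit : y - (x + lp.single p i (σ * t)) =
        (z - lp.single p i (z i)) + lp.single p i (z i - σ * t) := by
      rw [lp.single_sub, hz]
      abel
    rw [Metric.mem_closedBall, dist_eq_norm, hsplit,
      Real.le_rpow_inv_iff_of_pos (norm_nonneg _) hpos.le hr, norm_add_rpow_of_disjoint hr]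
    · gcongr
      · refine le_trans (lp.norm_mono hp0 fun j => ?_) (hy.trans (le_abs_self M))
        rw [lp.coeFn_sub, Pi.sub_apply, lp.single_apply]
        by_cases hj : j = i
        · subst hj
          simp
        · simp [hj]
      · rw [lp.norm_single (pos_iff_ne_zero.2 hp0)]
        have : z i - σ * t = σ * (σ * z i - t) := by linear_combination (-z i) * hσσ
        rw [this, norm_mul, Real.norm_eq_abs, hσ, one_mul, Real.norm_eq_abs,
          abs_of_nonpos (by linarith)]
        linarith
    · intro j
      rw [lp.coeFn_sub, Pi.sub_apply, lp.single_apply, lp.single_apply]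
      by_cases hj : j = i
      · subst hj
        simp
      · simp [hj]

theorem exists_finset_forall_le_abs_of_notMem {p : ℝ≥0∞} {C : Set (Ell p)}
    (hC : IsClosed[coordTop p] C) {x : Ell p} (hx : x ∉ C) :
    ∃ (s : Finset ℕ) (ε : ℝ), 0 < ε ∧ ∀ y ∈ C, ∃ i ∈ s, ε ≤ |(y - x) i| := by
  obtain ⟨D, hD, rfl⟩ := isClosed_induced_iff.1 hC
  obtain ⟨s, ε, hε, hsub⟩ : ∃ (s : Finset ℕ) (ε : ℝ), 0 < ε ∧
      ∀ z : ℕ → ℝ, (∀ i ∈ s, |z i - x i| < ε) → z ∉ D := by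
    have hnhds : Dᶜ ∈ nhds (fun i => x i) := hD.isOpen_compl.mem_nhds hx
    rw [nhds_pi, Filter.mem_pi] at hnhds
    obtain ⟨I, hI, t, ht, hsub⟩ := hnhds
    choose ε hε hball using fun i => Metric.mem_nhds_iff.1 (ht i)
    obtain ⟨δ, hδ, hle⟩ : ∃ δ : ℝ, 0 < δ ∧ ∀ i ∈ hI.toFinset, δ ≤ ε i := by
      refine ⟨(insert 1 (hI.toFinset.image ε)).min' (Finset.insert_nonempty _ _), ?_, fun i hi => ?_⟩
      · rw [Finset.lt_min'_iff]
        simp only [Finset.mem_insert, Finset.mem_image]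
        rintro _ (rfl | ⟨i, -, rfl⟩)
        exacts [one_pos, hε i]
      · exact Finset.min'_le _ _ (Finset.mem_insert_of_mem (Finset.mem_image_of_mem _ hi))
    refine ⟨hI.toFinset, δ, hδ, fun z hz => hsub fun i hi => hball i ?_⟩
    have hi' : i ∈ hI.toFinset := hI.mem_toFinset.2 hi
    rw [Metric.mem_ball, Real.dist_eq]
    exact (hz i hi').trans_le (hle i hi')
  refine ⟨s, ε, hε, fun y hy => ?_⟩
  by_contra! h
  exact hsub _ h hy

theorem isInterOfFiniteUnions_isClosedBall {p : ℝ≥0∞} [Fact (1 ≤ p)] (hp₁ : 1 < p) (hp : p < ∞)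
    {C : Set (Ell p)} (hbd : Bornology.IsBounded C) (hC : IsClosed[coordTop p] C) :
    IsInterOfFiniteUnions IsClosedBall C := by
  have hsep : ∀ x ∉ C, ∃ A, IsFiniteUnion IsClosedBall A ∧ C ⊆ A ∧ x ∉ A := by
    intro x hx
    obtain ⟨s, ε, hε, hs⟩ := exists_finset_forall_le_abs_of_notMem hC hx
    obtain ⟨M, hM⟩ := hbd.subset_closedBall x
    choose B hB hxB hBmem using fun (i : ℕ) (b : Bool) =>
      exists_closedBall_separating hp₁ hp x i (σ := if b then 1 else -1)
        (by cases b <;> simp) (M := M) hε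
    refine ⟨_, ⟨(fun q : ℕ × Bool => B q.1 q.2) '' (s ×ˢ Finset.univ : Finset (ℕ × Bool)),
      (Finset.finite_toSet _).image _, ?_, rfl⟩, ?_, ?_⟩
    · rintro _ ⟨q, -, rfl⟩
      exact hB _ _
    · intro y hy
      obtain ⟨i, hi, hle⟩ := hs y hy
      have hyM : ‖y - x‖ ≤ M := by simpa [dist_eq_norm] using hM hy
      rcases le_abs.1 hle with h | h
      · exact ⟨_, ⟨(i, true), by simpa using hi, rfl⟩, hBmem i true y hyM (by simpa using h)⟩
      · exact ⟨_, ⟨(i, false), by simpa using hi, rfl⟩, hBmem i false y hyM (by simpa using h)⟩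
    · rintro ⟨_, ⟨q, -, rfl⟩, hxq⟩
      exact hxB _ _ hxq
  -- A ball that contains `C` witnesses that the family is nonempty.
  obtain ⟨R, hR, hCR⟩ := hbd.subset_closedBall_lt 0 0
  refine ⟨{A | IsFiniteUnion IsClosedBall A ∧ C ⊆ A}, ⟨Metric.closedBall 0 R, ?_, hCR⟩,
    fun A hA => hA.1, ?_⟩
  · exact ⟨{Metric.closedBall 0 R}, Set.finite_singleton _,
      fun B hB => ⟨0, R, hR, hB⟩, (Set.sUnion_singleton _).symm⟩
  · refine Set.Subset.antisymm (Set.subset_sInter fun A hA => hA.2) fun x hx => ?_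
    by_contra hxC
    obtain ⟨A, hA, hCA, hxA⟩ := hsep x hxC
    exact hxA (hx A ⟨hA, hCA⟩)

/-! ### Intersections of finite unions -/

theorem IsClosedBall.isBoundedClosedConvex {X : Type*} [NormedAddCommGroup X] [NormedSpace ℝ X]
    {B : Set X} (hB : IsClosedBall B) : IsBoundedClosedConvex B := by
  obtain ⟨x, r, -, rfl⟩ := hB
  exact ⟨Metric.isBounded_closedBall, Metric.isClosed_closedBall, convex_closedBall x r⟩

theorem IsInterOfFiniteUnions.mono {X : Type*} {P Q : Set X → Prop} (h : ∀ B, P B → Q B)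
    {C : Set X} (hC : IsInterOfFiniteUnions P C) : IsInterOfFiniteUnions Q C := by
  obtain ⟨𝓐, hne, h𝓐, rfl⟩ := hC
  refine ⟨𝓐, hne, fun A hA => ?_, rfl⟩
  obtain ⟨𝓑, hfin, h𝓑, rfl⟩ := h𝓐 A hA
  exact ⟨𝓑, hfin, fun B hB => h B (h𝓑 B hB), rfl⟩

theorem IsInterOfFiniteUnions.isClosed {X : Type*} [TopologicalSpace X] {C : Set X}
    (hC : IsInterOfFiniteUnions IsClosed C) : IsClosed C := by
  obtain ⟨𝓐, -, h𝓐, rfl⟩ := hC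
  refine isClosed_sInter fun A hA => ?_
  obtain ⟨𝓑, hfin, h𝓑, rfl⟩ := h𝓐 A hA
  rw [Set.sUnion_eq_biUnion]
  exact hfin.isClosed_biUnion h𝓑

theorem IsInterOfFiniteUnions.isBounded {X : Type*} [Bornology X] {C : Set X}
    (hC : IsInterOfFiniteUnions Bornology.IsBounded C) : Bornology.IsBounded C := by
  obtain ⟨𝓐, ⟨A, hA⟩, h𝓐, rfl⟩ := hC
  refine Bornology.IsBounded.subset ?_ (Set.sInter_subset_of_mem hA)
  obtain ⟨𝓑, hfin, h𝓑, rfl⟩ := h𝓐 A hA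
  exact (Bornology.isBounded_sUnion hfin).2 h𝓑

end SeqSpace

theorem mainTheorem2 (p : ℝ≥0∞) [Fact (1 ≤ p)] (hp₁ : 1 < p) (hp : p < ∞)
    (C : TopologicalSpace.Closeds (SeqSpace.Ell p)) :
    List.TFAE [
      Bornology.IsBounded (C : Set (SeqSpace.Ell p)) ∧
        C = SeqSpace.pull (SeqSpace.toLimit p) (SeqSpace.push (SeqSpace.toLimit p) C),
      SeqSpace.IsInterOfFiniteUnions SeqSpace.IsClosedBall (C : Set (SeqSpace.Ell p)),
      SeqSpace.IsInterOfFiniteUnions SeqSpace.IsBoundedClosedConvex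
        (C : Set (SeqSpace.Ell p))] := by
  rw [SeqSpace.eq_pull_push_iff]
  tfae_have 1 → 2 := fun ⟨hbd, hcl⟩ =>
    SeqSpace.isInterOfFiniteUnions_isClosedBall hp₁ hp hbd hcl
  tfae_have 2 → 3 := fun h => h.mono fun _ hB => hB.isBoundedClosedConvex
  tfae_have 3 → 1 := fun h =>
    ⟨(h.mono fun _ hB => hB.1).isBounded,
      letI := SeqSpace.coordTop p
      (h.mono fun _ hB => hB.isClosed_coordTop hp₁ hp).isClosed⟩
  tfae_finish
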